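/- For $x\in\{0,1\}^n$ let $\mathrm{OMB}_n(x)=k \bmod 2$, where $k$ is the largest index in $\{1,\dots,n\}$ with $x_k=1$ ($k=0$ if $x=0^n$), and for $a,b\in\{0,1\}^n$ let $\mathrm{DOMB}_n(a,b)=\mathrm{OMB}_n(a\wedge b)$, where $\wedge$ is the bitwise AND. For $f:\{0,1\}^n\to\{0,1\}$ let $UQ(f)$ be the minimum number of queries to the black box $|i,c\rangle\mapsto|i,c\oplus x_i\rangle$ made by a quantum query algorithm that on every input $x\in\{0,1\}^n$ outputs $f(x)$ with probability strictly greater than $1/2$. For $g:\{0,1\}^{n_1}\times\{0,1\}^{n_2}\to\{0,1\}$ let $UQC(g)$ be the minimum number of qubits sent in a two-way quantum communication protocol (without prior entanglement or shared randomness, the output being produced by one of the two parties) that on every input pair $(a,b)$ outputs $g(a,b)$ with probability strictly greater than $1/2$. Then for every integer $n\ge 1$: $$UQ(\mathrm{OMB}_n)=1\qquad\text{and}\qquad UQC(\mathrm{DOMB}_n)\ \ge\ \frac{\log_2 n-3}{2}.$$ -/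

import Mathlib

open scoped Matrix

/-! Bits are elements of `Fin 2`: addition is XOR and multiplication is AND. -/

/-- `OMB n x = k mod 2`, where `k` is the largest `1`-based position of a one in `x`, and
`k = 0` if `x` is the all-zero string. -/
def OMB (n : ℕ) (x : Fin n → Fin 2) : Fin 2 :=
  ⟨((Finset.univ.filter fun i => x i = 1).sup fun i => i.val + 1) % 2,
    Nat.mod_lt _ Nat.two_pos⟩

/-- `DOMB n a b = OMB n (a ∧ b)`, with the bitwise AND. -/
def DOMB (n : ℕ) (a b : Fin n → Fin 2) : Fin 2 :=
  OMB n fun i => a i * b i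

/-! ### Quantum query algorithms -/

/-- Computational basis states `|i, c, w⟩` of a query algorithm on `n`-bit inputs: an index
register, a target qubit and a workspace of dimension `d`. -/
abbrev QueryBasis (n d : ℕ) : Type := Fin n × Fin 2 × Fin d

/-- The action of the black box `|i, c, w⟩ ↦ |i, c ⊕ x i, w⟩` on a vector of amplitudes.
The basis permutation is an involution, so no inverse is visible. -/
def oracle {n d : ℕ} (x : Fin n → Fin 2) (ψ : QueryBasis n d → ℂ) : QueryBasis n d → ℂ :=
  fun s => ψ (s.1, s.2.1 + x s.1, s.2.2)

/-- A quantum query algorithm for `n`-bit inputs: it starts in a basis state, applies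
`U 0, O_x, U 1, O_x, …, O_x, U queries` where the unitaries `U t` do not depend on the input `x`,
measures in the computational basis, and outputs a bit computed from the outcome. -/
structure QueryAlgorithm (n : ℕ) where
  /-- the number of queries -/
  queries : ℕ
  /-- the dimension of the workspace -/
  dim : ℕ
  /-- the initial basis state -/
  init : QueryBasis n dim
  /-- the input-independent unitaries (only those with index at most `queries` are used) -/
  U : ℕ → Matrix.unitaryGroup (QueryBasis n dim) ℂ
  /-- the output as a function of the measurement outcome -/
  out : QueryBasis n dim → Fin 2

/-- The state after `t` queries (and the unitary that follows the last of them). -/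
def QueryAlgorithm.state {n : ℕ} (Q : QueryAlgorithm n) (x : Fin n → Fin 2) :
    ℕ → (QueryBasis n Q.dim → ℂ)
  | 0 => (Q.U 0).1 *ᵥ Pi.single Q.init 1
  | t + 1 => (Q.U (t + 1)).1 *ᵥ oracle x (Q.state x t)

/-- The probability that the algorithm outputs `z` on input `x`. -/
noncomputable def QueryAlgorithm.outputProb {n : ℕ} (Q : QueryAlgorithm n) (x : Fin n → Fin 2)
    (z : Fin 2) : ℝ :=
  ∑ s with Q.out s = z, ‖Q.state x Q.queries s‖ ^ 2

/-- The unbounded error quantum query complexity of `f`: the least number of queries of a quantum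
query algorithm that outputs `f x` with probability greater than `1/2` on every input `x`. -/
noncomputable def UQ {n : ℕ} (f : (Fin n → Fin 2) → Fin 2) : ℕ :=
  sInf {T | ∃ Q : QueryAlgorithm n, Q.queries = T ∧ ∀ x, 1 / 2 < Q.outputProb x (f x)}

/-! ### Two-way quantum communication protocols without prior entanglement -/

/-- `QProtocol X Y a b c` is a two-way quantum protocol, or the rest of one, for Alice with input
in `X` and private register of dimension `a`, and Bob with input in `Y` and private register of
dimension `b`, in which `c` qubits are still to be sent.

A local operation is an isometry that depends on the input of the party that applies it, that is,
adding ancillas in a fixed state followed by a unitary. A party sends a qubit by applying an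
isometry into (new private register) ⊗ (qubit) and passing the qubit to the other party, whose
private register it joins. In the end one party applies an isometry into (register) ⊗ (qubit),
measures that qubit, and outputs the result. -/
inductive QProtocol (X Y : Type) : ℕ → ℕ → ℕ → Type
  | aliceOutput {a b : ℕ} (a' : ℕ) (V : X → Matrix (Fin a' × Fin 2) (Fin a) ℂ)
      (isom : ∀ x, (V x)ᴴ * V x = 1) : QProtocol X Y a b 0
  | bobOutput {a b : ℕ} (b' : ℕ) (V : Y → Matrix (Fin b' × Fin 2) (Fin b) ℂ)
      (isom : ∀ y, (V y)ᴴ * V y = 1) : QProtocol X Y a b 0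
  | aliceSend {a b c : ℕ} (a' : ℕ) (V : X → Matrix (Fin a' × Fin 2) (Fin a) ℂ)
      (isom : ∀ x, (V x)ᴴ * V x = 1) (rest : QProtocol X Y a' (b * 2) c) :
      QProtocol X Y a b (c + 1)
  | bobSend {a b c : ℕ} (b' : ℕ) (V : Y → Matrix (Fin b' × Fin 2) (Fin b) ℂ)
      (isom : ∀ y, (V y)ᴴ * V y = 1) (rest : QProtocol X Y (a * 2) b' c) :
      QProtocol X Y a b (c + 1)

/-- The probability that the protocol outputs `z` on inputs `x`, `y`, if run from the joint state
`ψ`, where `ψ i j` is the amplitude of `|i⟩ ⊗ |j⟩`. Thus an operator `V` of Alice maps `ψ` to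
`V * ψ`, and an operator `V` of Bob maps `ψ` to `ψ * Vᵀ`. The basis of a register that has received
a qubit is indexed through `finProdFinEquiv`. -/
noncomputable def QProtocol.outputProb {X Y : Type} (x : X) (y : Y) (z : Fin 2) :
    {a b c : ℕ} → QProtocol X Y a b c → Matrix (Fin a) (Fin b) ℂ → ℝ
  | _, _, _, .aliceOutput _ V _, ψ => ∑ i, ∑ j, ‖(V x * ψ) (i, z) j‖ ^ 2
  | _, _, _, .bobOutput _ V _, ψ => ∑ i, ∑ j, ‖(ψ * (V y)ᵀ) i (j, z)‖ ^ 2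
  | _, _, _, .aliceSend _ V _ rest, ψ =>
      rest.outputProb x y z <| Matrix.of fun i j =>
        (V x * ψ) (i, (finProdFinEquiv.symm j).2) (finProdFinEquiv.symm j).1
  | _, _, _, .bobSend _ V _ rest, ψ =>
      rest.outputProb x y z <| Matrix.of fun i j =>
        (ψ * (V y)ᵀ) (finProdFinEquiv.symm i).1 (j, (finProdFinEquiv.symm i).2)

/-- The unbounded error two-way quantum communication complexity of `g`: the least number of qubits
sent in a protocol that outputs `g x y` with probability greater than `1/2` on all inputs `x`, `y`.
Both private registers are initially trivial (of dimension `1`), so the parties share neither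
entanglement nor randomness. -/
noncomputable def UQC {n₁ n₂ : ℕ} (g : (Fin n₁ → Fin 2) → (Fin n₂ → Fin 2) → Fin 2) : ℕ :=
  sInf {c | ∃ P : QProtocol (Fin n₁ → Fin 2) (Fin n₂ → Fin 2) 1 1 c,
    ∀ x y, 1 / 2 < P.outputProb x y (g x y) 1}

/-! One query suffices because `OMB` is a threshold function: if position k (counted from 1) votes
for its parity with weight 2^k, the highest one outvotes all lower ones together with a unit default
vote for 0 (`OMB_threshold`). Sampling a position in proportion to its weight, querying it, and
tossing a fair coin on answer 0 turns this margin into a bias. Without queries the output cannot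
depend on the input.

For communication, the acceptance probabilities of a protocol with c qubits form a matrix of rank at
most 4^c (`QProtocol.exists_outputProb_eq_sum`), so at most 4^c + 1 after subtracting 1/2. Its
entries are positive exactly where `DOMB` is 1 and negative elsewhere. Against unit vectors at odd
positions `DOMB` reads off a bit of a (`DOMB_single`), so every sign pattern on at least n/2 columns
occurs, and this forces rank at least n/2 (`card_le_of_all_sign_patterns`). -/

/-! ### Query complexity of `OMB`. -/

theorem Matrix.exists_unitary_mulVec_single {ι : Type*} [Fintype ι] [DecidableEq ι] (i₀ : ι)
    (v : ι → ℂ) (hv : ∑ i, ‖v i‖ ^ 2 = 1) :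
    ∃ U : Matrix.unitaryGroup ι ℂ, U.1 *ᵥ Pi.single i₀ 1 = v := by
  have hnorm : ‖WithLp.toLp 2 v‖ = 1 := by
    rw [EuclideanSpace.norm_eq, Real.sqrt_eq_one]
    exact hv
  have horth : Orthonormal ℂ
      (({i₀} : Set ι).domRestrict fun _ => (WithLp.toLp 2 v : EuclideanSpace ℂ ι)) := by
    constructor
    · intro i
      exact hnorm
    · intro i j hij
      exact absurd (Subsingleton.elim i j) hij
  obtain ⟨b, hb⟩ := horth.exists_orthonormalBasis_extension_of_card_eq (by simp)
  refine ⟨⟨(EuclideanSpace.basisFun ι ℂ).toBasis.toMatrix b,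
    OrthonormalBasis.toMatrix_orthonormalBasis_mem_unitary _ _⟩, ?_⟩
  ext i
  simp [Module.Basis.toMatrix_apply, hb i₀ rfl]

theorem Matrix.sum_norm_sq_mulVec_unitary {ι : Type*} [Fintype ι] [DecidableEq ι]
    (U : Matrix.unitaryGroup ι ℂ) (v : ι → ℂ) :
    ∑ i, ‖(U.1 *ᵥ v) i‖ ^ 2 = ∑ i, ‖v i‖ ^ 2 := by
  have key (w : ι → ℂ) : ((∑ i, ‖w i‖ ^ 2 : ℝ) : ℂ) = star w ⬝ᵥ w := by
    simp [dotProduct, Complex.conj_mul']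
  have hU : (U.1)ᴴ * U.1 = 1 := Matrix.mem_unitaryGroup_iff'.mp U.2
  have h : ((∑ i, ‖(U.1 *ᵥ v) i‖ ^ 2 : ℝ) : ℂ) = ((∑ i, ‖v i‖ ^ 2 : ℝ) : ℂ) := by
    rw [key, key, Matrix.star_mulVec, Matrix.dotProduct_mulVec, Matrix.vecMul_vecMul, hU,
      Matrix.vecMul_one]
  exact_mod_cast h

/-- The output distribution of an algorithm without queries does not depend on the input. -/
theorem QueryAlgorithm.outputProb_add_of_queries_eq_zero {n : ℕ} (Q : QueryAlgorithm n)
    (hQ : Q.queries = 0) (x y : Fin n → Fin 2) :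
    Q.outputProb x 0 + Q.outputProb y 1 = 1 := by
  have hout (s : QueryBasis n Q.dim) : Q.out s = 1 ↔ ¬ Q.out s = 0 := by omega
  simp only [QueryAlgorithm.outputProb, hQ, QueryAlgorithm.state, hout]
  rw [Finset.sum_filter_add_sum_filter_not, Matrix.sum_norm_sq_mulVec_unitary,
    Finset.sum_eq_single Q.init]
  · simp
  · intro s _ hs
    simp [hs]
  · simp

/-- A single query to a classically sampled position. -/
theorem QueryAlgorithm.exists_one_query {n d : ℕ} (s₀ : QueryBasis n d)
    (w : QueryBasis n d → ℝ) (hw : ∀ s, 0 ≤ w s) (hpos : 0 < ∑ s, w s)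
    (out : QueryBasis n d → Fin 2) :
    ∃ Q : QueryAlgorithm n, Q.queries = 1 ∧ ∀ x z, Q.outputProb x z =
      (∑ s with out s = z, w (s.1, s.2.1 + x s.1, s.2.2)) / ∑ s, w s := by
  have hsq (s : QueryBasis n d) :
      ‖((√(w s / ∑ s, w s) : ℝ) : ℂ)‖ ^ 2 = w s / ∑ s, w s := by
    rw [Complex.norm_real, Real.norm_eq_abs, sq_abs, Real.sq_sqrt (div_nonneg (hw s) hpos.le)]
  obtain ⟨U, hU⟩ := Matrix.exists_unitary_mulVec_single s₀
    (fun s => ((√(w s / ∑ s, w s) : ℝ) : ℂ)) (by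
      simp only [hsq]
      rw [← Finset.sum_div, div_self hpos.ne'])
  refine ⟨⟨1, d, s₀, fun t => if t = 0 then U else 1, out⟩, rfl, fun x z => ?_⟩
  rw [Finset.sum_div]
  simp only [QueryAlgorithm.outputProb, QueryAlgorithm.state]
  refine Finset.sum_congr rfl fun s _ => ?_
  rw [← hsq]
  simp [oracle, hU]

theorem OMB_eq_zero_of_forall {n : ℕ} {x : Fin n → Fin 2} (hx : ∀ i, x i ≠ 1) : OMB n x = 0 := by
  simp [OMB, hx]

theorem OMB_eq_of_isGreatest {n : ℕ} {x : Fin n → Fin 2} {k : Fin n} (hk : x k = 1)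
    (hmax : ∀ i, x i = 1 → i ≤ k) : OMB n x = ⟨(k.val + 1) % 2, Nat.mod_lt _ Nat.two_pos⟩ := by
  have : ((Finset.univ.filter fun i => x i = 1).sup fun i => i.val + 1) = k.val + 1 := by
    apply le_antisymm
    · refine Finset.sup_le fun i hi => ?_
      have := hmax i (Finset.mem_filter.mp hi).2
      omega
    · exact Finset.le_sup (f := fun i : Fin n => i.val + 1) (by simp [hk])
  simp [OMB, this]

/-- `OMB` is a threshold function with exponentially growing weights. -/
theorem OMB_threshold {n : ℕ} (x : Fin n → Fin 2) (ε : Fin 2 → ℝ)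
    (hε : ε (OMB n x) = 1) (habs : ∀ z, |ε z| = 1) :
    0 < ε 0 + ∑ i : Fin n,
      if x i = 1 then ε ⟨(i.val + 1) % 2, Nat.mod_lt _ Nat.two_pos⟩ * 2 ^ (i.val + 1) else 0 := by
  by_cases hx : ∃ i, x i = 1
  · obtain ⟨k, hk⟩ := (Finset.univ.filter fun i => x i = 1).exists_maximal
      (by obtain ⟨i, hi⟩ := hx; exact ⟨i, by simp [hi]⟩)
    have hk1 : x k = 1 := (Finset.mem_filter.mp hk.1).2
    have hmax (i : Fin n) (hi : x i = 1) : i ≤ k := by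
      by_contra h
      exact h (hk.2 (by simp [hi]) (le_of_not_ge h))
    rw [OMB_eq_of_isGreatest hk1 hmax] at hε
    have hgeom : ∀ m : ℕ, ∑ i ∈ Finset.range m, (2 : ℝ) ^ (i + 1) = 2 ^ (m + 1) - 2 := by
      intro m
      induction m with
      | zero => norm_num
      | succ m ih => rw [Finset.sum_range_succ, ih]; ring
    have hlow : ∑ i ∈ Finset.univ.erase k, (if i < k then (2 : ℝ) ^ (i.val + 1) else 0) =
        2 ^ (k.val + 1) - 2 := by
      rw [Finset.sum_erase _ (by simp), ← hgeom, ← Finset.sum_filter]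
      refine Finset.sum_nbij (fun i => i.val) ?_ ?_ ?_ ?_
      · intro i hi
        simpa using hi
      · exact fun i _ j _ h => Fin.ext h
      · intro i hi
        have hi' : i < k.val := by simpa using hi
        exact ⟨⟨i, hi'.trans k.isLt⟩, 
          Finset.mem_coe.2 (Finset.mem_filter.2 ⟨Finset.mem_univ _, hi'⟩), rfl⟩
      · intro i _
        rfl
    have hge : ∑ i ∈ Finset.univ.erase k, -(if i < k then (2 : ℝ) ^ (i.val + 1) else 0) ≤
        ∑ i ∈ Finset.univ.erase k, if x i = 1 then
          ε ⟨(i.val + 1) % 2, Nat.mod_lt _ Nat.two_pos⟩ * 2 ^ (i.val + 1) else 0 := by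
      refine Finset.sum_le_sum fun i hi => ?_
      by_cases h1 : x i = 1
      · have hlt : i < k := lt_of_le_of_ne (hmax i h1) (Finset.ne_of_mem_erase hi)
        have := neg_le_of_abs_le (habs ⟨(i.val + 1) % 2, Nat.mod_lt _ Nat.two_pos⟩).le
        have h2 : (0 : ℝ) < 2 ^ (i.val + 1) := by positivity
        simp only [h1, hlt, if_true]
        nlinarith
      · simp only [h1, if_false]
        split_ifs
        · simp
        · simp
    -- The lower positions cost at most 2^(k+1) - 2 and the default vote at most 1, so the top vote
    -- 2^(k+1) wins by at least 1.
    rw [Finset.sum_neg_distrib, hlow] at hge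
    rw [← Finset.add_sum_erase _ _ (Finset.mem_univ k)]
    have h0 := neg_le_of_abs_le (habs 0).le
    simp only [hk1, if_true, hε]
    linarith
  · push Not at hx
    rw [OMB_eq_zero_of_forall hx] at hε
    simp [hx, hε]

theorem UQ_OMB {n : ℕ} (hn : 1 ≤ n) : UQ (OMB n) = 1 := by
  have hmem : ∃ Q : QueryAlgorithm n, Q.queries = 1 ∧ ∀ x, 1 / 2 < Q.outputProb x (OMB n x) := by
    -- Workspace 2 carries the default vote for 0. Workspaces 0 and 1 query position i with weight
    -- 2^i each: on answer 1 both vote for its parity, total 2^(i+1); on answer 0 they vote 0 and 1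
    -- and cancel.
    let w : QueryBasis n 3 → ℝ := fun s =>
      if s.2.1 = 0 then (if s.2.2 = 2 then (if s.1 = ⟨0, hn⟩ then 1 else 0) else 2 ^ s.1.val) else 0
    let out : QueryBasis n 3 → Fin 2 := fun s =>
      if s.2.2 = 2 then 0 else if s.2.1 = 1 then ⟨(s.1.val + 1) % 2, Nat.mod_lt _ Nat.two_pos⟩
      else if s.2.2 = 0 then 0 else 1
    have hw (s) : 0 ≤ w s := by
      simp only [w]
      split_ifs <;> positivity
    have hpos : 0 < ∑ s, w s :=
      Finset.sum_pos' (fun s _ => hw s) ⟨(⟨0, hn⟩, 0, 2), Finset.mem_univ _, by simp [w]⟩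
    obtain ⟨Q, hQ, hprob⟩ := QueryAlgorithm.exists_one_query (⟨0, hn⟩, 0, 0) w hw hpos out
    refine ⟨Q, hQ, fun x => ?_⟩
    rw [hprob, lt_div_iff₀ hpos]
    set z := OMB n x with hz
    let ε : Fin 2 → ℝ := fun c => if c = z then 1 else -1
    have htotal : ∑ s : QueryBasis n 3, w (s.1, s.2.1 + x s.1, s.2.2) = ∑ s, w s := by
      simp only [Fintype.sum_prod_type]
      refine Finset.sum_congr rfl fun i _ => ?_
      exact Fintype.sum_equiv (Equiv.addRight (x i)) _ _ fun _ => rfl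
    have hdiff : ∑ s : QueryBasis n 3, ε (out s) * w (s.1, s.2.1 + x s.1, s.2.2) =
        2 * (∑ s with out s = z, w (s.1, s.2.1 + x s.1, s.2.2)) - ∑ s, w s := by
      rw [← htotal, Finset.sum_filter, Finset.mul_sum, ← Finset.sum_sub_distrib]
      refine Finset.sum_congr rfl fun s _ => ?_
      simp only [ε]
      split_ifs <;> ring
    have hthr := OMB_threshold x ε (by simp [ε, hz]) (fun c => by simp only [ε]; split_ifs <;> simp)
    have heq : ∑ s : QueryBasis n 3, ε (out s) * w (s.1, s.2.1 + x s.1, s.2.2) =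
        ε 0 + ∑ i : Fin n, if x i = 1 then
          ε ⟨(i.val + 1) % 2, Nat.mod_lt _ Nat.two_pos⟩ * 2 ^ (i.val + 1) else 0 := by
      have hfirst : ε 0 = ∑ i : Fin n, if i = ⟨0, hn⟩ then ε 0 else 0 := by simp
      have hcancel : ε 0 + ε 1 = 0 := by
        have : z = 0 ∨ z = 1 := by omega
        rcases this with h | h <;> simp [ε, h]
      rw [hfirst, ← Finset.sum_add_distrib]
      simp only [Fintype.sum_prod_type]
      refine Finset.sum_congr rfl fun i _ => ?_
      have hxi : x i = 0 ∨ x i = 1 := by omega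
      rcases hxi with h | h
      · simp [Fin.sum_univ_three, w, out, h]
        linear_combination 2 ^ i.val * hcancel
      · simp [Fin.sum_univ_three, w, out, h]
        ring
    linarith
  apply le_antisymm
  · exact Nat.sInf_le hmem
  · refine le_csInf ⟨1, hmem⟩ ?_
    rintro T ⟨Q, rfl, hQ⟩
    by_contra hT
    have h0 := hQ 0
    have h1 := hQ (Pi.single ⟨0, hn⟩ 1)
    rw [OMB_eq_zero_of_forall (by simp)] at h0
    rw [OMB_eq_of_isGreatest (k := ⟨0, hn⟩) (by simp) (by
      intro i hi
      by_contra h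
      have hne : i ≠ ⟨0, hn⟩ := fun he => h he.le
      simp [hne] at hi)] at h1
    have := Q.outputProb_add_of_queries_eq_zero (by omega) 0 (Pi.single ⟨0, hn⟩ 1)
    have h1' : 1 / 2 < Q.outputProb (Pi.single ⟨0, hn⟩ 1) 1 := h1
    linarith

/-! ### Norms and rank bounds for communication protocols. -/

theorem Matrix.ofReal_sum_sum_norm_sq {m n : Type*} [Fintype m] [Fintype n] (A : Matrix m n ℂ) :
    ((∑ i, ∑ j, ‖A i j‖ ^ 2 : ℝ) : ℂ) = (Aᴴ * A).trace := by
  rw [Finset.sum_comm]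
  simp [Matrix.trace, Matrix.mul_apply, Complex.conj_mul']

theorem Matrix.sum_sum_norm_sq_isometry_mul {m n k : Type*} [Fintype m] [Fintype n] [Fintype k]
    [DecidableEq n] (V : Matrix m n ℂ) (hV : Vᴴ * V = 1) (ψ : Matrix n k ℂ) :
    ∑ i, ∑ j, ‖(V * ψ) i j‖ ^ 2 = ∑ i, ∑ j, ‖ψ i j‖ ^ 2 := by
  have h : ((∑ i, ∑ j, ‖(V * ψ) i j‖ ^ 2 : ℝ) : ℂ) = ((∑ i, ∑ j, ‖ψ i j‖ ^ 2 : ℝ) : ℂ) := by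
    rw [Matrix.ofReal_sum_sum_norm_sq, Matrix.ofReal_sum_sum_norm_sq, Matrix.conjTranspose_mul,
      Matrix.mul_assoc, ← Matrix.mul_assoc Vᴴ, hV, Matrix.one_mul]
  exact_mod_cast h

/-- The squared norm of a product as a bilinear form in the Gram matrices of its factors. -/
theorem Matrix.ofReal_sum_sum_norm_sq_mul {m n κ : Type*} [Fintype m] [Fintype n] [Fintype κ]
    (C : Matrix m κ ℂ) (D : Matrix κ n ℂ) :
    ((∑ i, ∑ j, ‖(C * D) i j‖ ^ 2 : ℝ) : ℂ) =
      ∑ p : κ × κ, (∑ i, star (C i p.1) * C i p.2) * ∑ j, star (D p.1 j) * D p.2 j := by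
  have hterm (i : m) (j : n) : ((‖(C * D) i j‖ ^ 2 : ℝ) : ℂ) =
      ∑ p : κ × κ, (star (C i p.1) * C i p.2) * (star (D p.1 j) * D p.2 j) := by
    push_cast
    rw [← Complex.conj_mul', Matrix.mul_apply, map_sum, Finset.sum_mul_sum, Fintype.sum_prod_type]
    refine Finset.sum_congr rfl fun k _ => Finset.sum_congr rfl fun l _ => ?_
    rw [map_mul, Complex.star_def]
    ring
  simp only [Complex.ofReal_sum, hterm, Finset.sum_mul_sum]
  rw [Finset.sum_congr rfl fun i _ => Finset.sum_comm, Finset.sum_comm]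

theorem Matrix.sum_sum_norm_sq_mul_isometry_transpose {m n k : Type*} [Fintype m] [Fintype n]
    [Fintype k] [DecidableEq n] (V : Matrix m n ℂ) (hV : Vᴴ * V = 1) (ψ : Matrix k n ℂ) :
    ∑ i, ∑ j, ‖(ψ * Vᵀ) i j‖ ^ 2 = ∑ i, ∑ j, ‖ψ i j‖ ^ 2 := by
  rw [Finset.sum_comm, Finset.sum_comm (f := fun i j => ‖ψ i j‖ ^ 2)]
  have := Matrix.sum_sum_norm_sq_isometry_mul V hV ψᵀ
  rw [← Matrix.transpose_transpose (ψ * Vᵀ), Matrix.transpose_mul, Matrix.transpose_transpose]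
  simpa only [Matrix.transpose_apply] using this

namespace QProtocol

/-- The output probabilities sum to the squared norm of the joint state. -/
theorem outputProb_add {X Y : Type} (x : X) (y : Y) {a b c : ℕ} (P : QProtocol X Y a b c)
    (ψ : Matrix (Fin a) (Fin b) ℂ) :
    P.outputProb x y 0 ψ + P.outputProb x y 1 ψ = ∑ i, ∑ j, ‖ψ i j‖ ^ 2 := by
  induction P with
  | aliceOutput a' V isom =>
    rw [← Matrix.sum_sum_norm_sq_isometry_mul _ (isom x), Fintype.sum_prod_type]
    simp [outputProb, Fin.sum_univ_two, Finset.sum_add_distrib]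
  | bobOutput b' V isom =>
    rw [← Matrix.sum_sum_norm_sq_mul_isometry_transpose _ (isom y)]
    simp [outputProb, Fin.sum_univ_two, Finset.sum_add_distrib, Fintype.sum_prod_type]
  | aliceSend a' V isom rest ih =>
    rw [← Matrix.sum_sum_norm_sq_isometry_mul _ (isom x), Fintype.sum_prod_type]
    simp only [outputProb, ih, Matrix.of_apply]
    refine Finset.sum_congr rfl fun i _ => ?_
    rw [Finset.sum_comm, ← Fintype.sum_prod_type',
      ← Fintype.sum_equiv finProdFinEquiv.symm _ _ fun _ => rfl]
  | bobSend b' V isom rest ih =>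
    rw [← Matrix.sum_sum_norm_sq_mul_isometry_transpose _ (isom y)]
    simp only [outputProb, ih, Matrix.of_apply]
    refine (Fintype.sum_equiv finProdFinEquiv.symm _
      (fun p => ∑ j, ‖(ψ * (V y)ᵀ) p.1 (j, p.2)‖ ^ 2) fun _ => rfl).trans ?_
    rw [Fintype.sum_prod_type]
    refine Finset.sum_congr rfl fun i _ => ?_
    rw [Finset.sum_comm, ← Fintype.sum_prod_type']

/-- If the initial state is `A x * B y` with inner index type `κ`, then the acceptance
probabilities form a matrix of rank at most `|κ| ^ 2 * 4 ^ c`. -/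
theorem exists_outputProb_eq_sum {X Y : Type} (z : Fin 2) {a b c : ℕ} (P : QProtocol X Y a b c)
    {κ : Type} [Fintype κ] (A : X → Matrix (Fin a) κ ℂ) (B : Y → Matrix κ (Fin b) ℂ) :
    ∃ (ι : Type) (_ : Fintype ι) (f : X → ι → ℂ) (g : Y → ι → ℂ),
      Fintype.card ι = Fintype.card κ ^ 2 * 4 ^ c ∧
      ∀ x y, (P.outputProb x y z (A x * B y) : ℂ) = ∑ i, f x i * g y i := by
  induction P generalizing κ with
  | aliceOutput a' V isom =>
    refine ⟨κ × κ, inferInstance, fun x p => ∑ i, star ((V x * A x) (i, z) p.1) *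
      (V x * A x) (i, z) p.2, fun y p => ∑ j, star (B y p.1 j) * B y p.2 j,
      by simp [sq], fun x y => ?_⟩
    have := Matrix.ofReal_sum_sum_norm_sq_mul ((V x * A x).submatrix (fun i => (i, z)) id) (B y)
    rw [outputProb, ← Matrix.mul_assoc]
    exact this
  | bobOutput b' V isom =>
    refine ⟨κ × κ, inferInstance, fun x p => ∑ i, star (A x i p.1) * A x i p.2,
      fun y p => ∑ j, star ((B y * (V y)ᵀ) p.1 (j, z)) * (B y * (V y)ᵀ) p.2 (j, z),
      by simp [sq], fun x y => ?_⟩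
    have := Matrix.ofReal_sum_sum_norm_sq_mul (A x) ((B y * (V y)ᵀ).submatrix id fun j => (j, z))
    rw [outputProb, Matrix.mul_assoc]
    exact this
  | @aliceSend a b c a' V isom rest ih =>
    -- The sent qubit joins the inner index, doubling |κ| and so costing a factor 4.
    obtain ⟨ι, hι, f, g, hcard, h⟩ := ih (κ := κ × Fin 2)
      (fun x => Matrix.of fun i p => (V x * A x) (i, p.2) p.1)
      (fun y => Matrix.of fun p j => if p.2 = (finProdFinEquiv.symm j).2 then
        B y p.1 (finProdFinEquiv.symm j).1 else 0)
    refine ⟨ι, hι, f, g, ?_, fun x y => ?_⟩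
    · rw [hcard, Fintype.card_prod, Fintype.card_fin]
      ring
    · rw [← h, outputProb]
      congr 2
      ext i j
      rw [Matrix.of_apply, ← Matrix.mul_assoc, Matrix.mul_apply, Matrix.mul_apply,
        Fintype.sum_prod_type]
      simp
  | @bobSend a b c b' V isom rest ih =>
    obtain ⟨ι, hι, f, g, hcard, h⟩ := ih (κ := κ × Fin 2)
      (fun x => Matrix.of fun i p => if p.2 = (finProdFinEquiv.symm i).2 then
        A x (finProdFinEquiv.symm i).1 p.1 else 0)
      (fun y => Matrix.of fun p j => (B y * (V y)ᵀ) p.1 (j, p.2))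
    refine ⟨ι, hι, f, g, ?_, fun x y => ?_⟩
    · rw [hcard, Fintype.card_prod, Fintype.card_fin]
      ring
    · rw [← h, outputProb]
      congr 2
      ext i j
      rw [Matrix.of_apply, Matrix.mul_assoc, Matrix.mul_apply, Matrix.mul_apply,
        Fintype.sum_prod_type]
      simp

/-- A function of `y`, a basis state held by Bob and `c` bits known to Alice is computed without
error by sending these `c` bits. -/
theorem exists_outputProb_eq_one {X Y : Type} {b c : ℕ} (φ : X → Fin b) (s : Fin c → X → Fin 2)
    (G : Fin b → (Fin c → Fin 2) → Y → Fin 2) :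
    ∃ P : QProtocol X Y 1 b c, ∀ x y,
      P.outputProb x y (G (φ x) (fun i => s i x) y) (Matrix.single 0 (φ x) 1) = 1 := by
  induction c generalizing b with
  | zero =>
    refine ⟨.bobOutput b (fun y => Matrix.of fun p j =>
      if p = (j, G j Fin.elim0 y) then 1 else 0) (fun y => ?_), fun x y => ?_⟩
    · ext i j
      simp [Matrix.mul_apply, Matrix.one_apply, ite_and]
      by_cases h : i = j
      · simp [h]
      · simp [h, Ne.symm h]
    · have : (fun i => s i x) = Fin.elim0 := Subsingleton.elim _ _
      simp [outputProb, Matrix.mul_apply, Matrix.single_apply, this, ite_and]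
      rw [Finset.sum_eq_single (φ x)]
      · simp
      · intro i _ hi
        simp [Ne.symm hi]
      · simp
  | succ c ih =>
    obtain ⟨P, hP⟩ := ih (b := b * 2) (fun x => finProdFinEquiv (φ x, s 0 x)) (fun i => s i.succ)
      (fun j t y => G (finProdFinEquiv.symm j).1 (Fin.cons (finProdFinEquiv.symm j).2 t) y)
    refine ⟨.aliceSend 1 (fun x => Matrix.of fun p _ => if p.2 = s 0 x then 1 else 0)
      (fun x => ?_) P, fun x y => ?_⟩
    · ext i j
      simp [Matrix.mul_apply, Fintype.sum_prod_type, Matrix.one_apply,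
        Subsingleton.elim i j]
    · rw [outputProb]
      convert hP x y using 2
      · rw [Equiv.symm_apply_apply]
        exact congrArg (G (φ x) · y) (Fin.cons_self_tail fun i => s i x).symm
      · ext i j
        obtain ⟨⟨k, q⟩, rfl⟩ := finProdFinEquiv.surjective j
        rw [Matrix.of_apply, Equiv.symm_apply_apply]
        simp only [Matrix.mul_apply, Matrix.single_apply, Subsingleton.elim i 0,
          EmbeddingLike.apply_eq_iff_eq, Prod.mk.injEq]
        by_cases hk : φ x = k
        · simp [hk, eq_comm]
        · simp [hk]

end QProtocol

/-- Alice can send her whole input. Nonemptiness matters because `sInf ∅ = 0`: it ensures that `UQC`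
is attained by a protocol. -/
theorem UQC_set_nonempty {n₁ n₂ : ℕ} (g : (Fin n₁ → Fin 2) → (Fin n₂ → Fin 2) → Fin 2) :
    {c | ∃ P : QProtocol (Fin n₁ → Fin 2) (Fin n₂ → Fin 2) 1 1 c,
      ∀ x y, 1 / 2 < P.outputProb x y (g x y) 1}.Nonempty := by
  obtain ⟨P, hP⟩ := QProtocol.exists_outputProb_eq_one (Y := Fin n₂ → Fin 2) (b := 1)
    (fun _ : Fin n₁ → Fin 2 => 0) (fun i x => x i) (fun _ t y => g t y)
  refine ⟨n₁, P, fun x y => ?_⟩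
  have h1 : (Matrix.single 0 0 1 : Matrix (Fin 1) (Fin 1) ℂ) = 1 := by
    ext i j
    simp [Matrix.one_apply, Subsingleton.elim i 0, Subsingleton.elim j 0]
  rw [← h1, hP]
  norm_num

/-! ### Sign patterns and the communication lower bound. -/

/-- A matrix whose rows realize all strict sign patterns has rank at least its number of columns. -/
theorem card_le_of_all_sign_patterns {X κ ι : Type*} [Fintype κ] [Fintype ι]
    (M : X → κ → ℝ) (f : X → ι → ℂ) (g : κ → ι → ℂ)
    (hM : ∀ x k, (M x k : ℂ) = ∑ i, f x i * g k i)
    (hsign : ∀ S : Set κ, ∃ x, ∀ k, (k ∈ S → 0 < M x k) ∧ (k ∉ S → M x k < 0)) :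
    Fintype.card κ ≤ Fintype.card ι := by
  by_contra hlt
  have hdep : ¬ LinearIndependent ℂ g := fun h => by
    have := h.fintype_card_le_finrank
    rw [Module.finrank_fintype_fun_eq_card] at this
    exact hlt this
  obtain ⟨l, hl, k, hk⟩ := Fintype.not_linearIndependent_iff.mp hdep
  -- The row that is positive exactly where `(m k).re` is positive makes every term of the real part
  -- of the relation nonnegative, and one term positive.
  have hrel (m : κ → ℂ) (hm : ∑ k, m k • g k = 0) (hk : 0 < (m k).re) : False := by
    obtain ⟨x, hx⟩ := hsign {k | 0 < (m k).re}
    have hzero : ∑ k, m k * M x k = 0 := by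
      simp only [hM, Finset.mul_sum]
      rw [Finset.sum_comm]
      refine Finset.sum_eq_zero fun i _ => ?_
      have := congrFun hm i
      simp only [Finset.sum_apply, Pi.smul_apply, smul_eq_mul, Pi.zero_apply] at this
      rw [← mul_zero (f x i), ← this, Finset.mul_sum]
      exact Finset.sum_congr rfl fun k _ => by ring
    have hre : ∑ k, (m k).re * M x k = 0 := by
      simpa [Complex.re_mul_ofReal] using congrArg Complex.re hzero
    refine (Finset.sum_pos' (fun j _ => ?_) ⟨k, Finset.mem_univ k, ?_⟩).ne' hre
    · by_cases hj : 0 < (m j).re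
      · exact (mul_pos hj ((hx j).1 hj)).le
      · exact mul_nonneg_of_nonpos_of_nonpos (not_lt.mp hj) ((hx j).2 hj).le
    · exact mul_pos hk ((hx k).1 hk)
  -- This scaling makes the k-th coefficient ‖l k‖² > 0.
  refine hrel (fun j => star (l k) * l j) ?_ ?_
  · simp only [mul_smul]
    rw [← Finset.smul_sum, hl, smul_zero]
  · have : star (l k) * l k = ((‖l k‖ ^ 2 : ℝ) : ℂ) := by
      rw [Complex.star_def, Complex.conj_mul']
      norm_cast
    simp only [this, Complex.ofReal_re]
    positivity

theorem DOMB_single {n : ℕ} (a : Fin n → Fin 2) (k : Fin n) (hk : k.val % 2 = 0) :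
    DOMB n a (Pi.single k 1) = a k := by
  have h : a k = 0 ∨ a k = 1 := by omega
  rcases h with h | h
  · rw [h]
    refine OMB_eq_zero_of_forall fun i => ?_
    by_cases hi : i = k
    · subst hi
      simp [h]
    · simp [hi]
  · rw [DOMB, OMB_eq_of_isGreatest (k := k) (by simp [h]), h]
    · ext
      simp
      omega
    · intro i hi
      by_contra hik
      have hne : i ≠ k := fun he => hik he.le
      simp [hne] at hi

theorem le_four_pow_of_protocol_DOMB {n c : ℕ}
    (P : QProtocol (Fin n → Fin 2) (Fin n → Fin 2) 1 1 c)
    (hP : ∀ x y, 1 / 2 < P.outputProb x y (DOMB n x y) 1) : n ≤ 2 * (4 ^ c + 1) := by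
  obtain ⟨ι, hι, f, g, hcard, h⟩ := P.exists_outputProb_eq_sum 1 (κ := Fin 1)
    (fun _ => 1) (fun _ => 1)
  -- Even 0-based indices are the odd 1-based positions.
  let e : Fin ((n + 1) / 2) → Fin n := fun j => ⟨2 * j.val, by omega⟩
  -- The extra point of `Option ι` accounts for the constant -1/2.
  have hle := card_le_of_all_sign_patterns (κ := Fin ((n + 1) / 2)) (ι := Option ι)
    (fun x j => P.outputProb x (Pi.single (e j) 1) 1 1 - 1 / 2)
    (fun x o => o.elim (-1 / 2) (f x)) (fun j o => o.elim 1 (g (Pi.single (e j) 1)))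
    (fun x j => by
      have := h x (Pi.single (e j) 1)
      rw [Matrix.one_mul] at this
      rw [Fintype.sum_option]
      push_cast
      rw [this]
      simp
      ring)
    (fun S => by
      classical
      refine ⟨fun i => if ∃ j ∈ S, e j = i then 1 else 0, fun j => ?_⟩
      have hinj : Function.Injective e := fun i j hij => by
        simp only [e, Fin.mk.injEq] at hij
        omega
      have hp := hP (fun i => if ∃ j ∈ S, e j = i then 1 else 0) (Pi.single (e j) 1)
      have hadd := P.outputProb_add (fun i => if ∃ j ∈ S, e j = i then 1 else 0)
        (Pi.single (e j) 1) 1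
      rw [DOMB_single _ _ (by simp [e])] at hp
      simp only [hinj.eq_iff, exists_eq_right] at hp
      simp only [Finset.univ_unique, Finset.sum_singleton, Matrix.one_apply_eq, norm_one,
        one_pow] at hadd
      constructor
      · intro hj
        simp only [hj, if_true] at hp
        linarith
      · intro hj
        simp only [hj, if_false] at hp
        linarith)
  rw [Fintype.card_fin, Fintype.card_option, hcard, Fintype.card_fin] at hle
  omega

theorem theorem3 (n : ℕ) (hn : 1 ≤ n) :
    UQ (OMB n) = 1 ∧ (Real.logb 2 n - 3) / 2 ≤ (UQC (DOMB n) : ℝ) := by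
  refine ⟨UQ_OMB hn, ?_⟩
  obtain ⟨P, hP⟩ := Nat.sInf_mem (UQC_set_nonempty (DOMB n))
  change QProtocol _ _ 1 1 (UQC (DOMB n)) at P
  have h := le_four_pow_of_protocol_DOMB P hP
  set c := UQC (DOMB n)
  have hle : n ≤ 2 ^ (2 * c + 3) := by
    have h4 : 2 ^ (2 * c + 3) = 8 * 4 ^ c := by rw [pow_add, pow_mul]; norm_num [mul_comm]
    have := Nat.one_le_pow c 4 (by norm_num)
    omega
  have hlog : Real.logb 2 n ≤ 2 * c + 3 := by
    rw [Real.logb_le_iff_le_rpow (by norm_num) (by exact_mod_cast hn)]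
    exact_mod_cast hle
  linarith
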